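/- **Dynamic programs.** Let $\Sigma$ be a finite alphabet. A word with $n$ positions is stored as a structure with domain $\{1,\dots,n\}$, the linear order $\le$ and a unary relation $W_\sigma$ for each $\sigma\in\Sigma$; each position carries a letter of $\Sigma$ or the empty symbol $\varepsilon$, and the word represented is the concatenation of the symbols at all positions. A change $\mathrm{set}_\sigma(i)$, $\sigma\in\Sigma\cup\{\varepsilon\}$, replaces the symbol at position $i$ by $\sigma$. A dynamic program has a finite relational schema of auxiliary relations, a first-order formula over words for each auxiliary relation, defining its initial value from the initial word $\varepsilon^n$, and for each auxiliary relation $R$ and each $\sigma\in\Sigma\cup\{\varepsilon\}$ an update formula $\varphi^R_\sigma(\bar x;y)$. After a change $\mathrm{set}_\sigma(i)$ the new relation $R$ consists of all tuples $\bar a$ such that $\varphi^R_\sigma(\bar a;i)$ holds in the structure formed by the new word and the old auxiliary relations. The program maintains a language $L\subseteq\Sigma^*$ if for every $n$ and every finite sequence of changes starting from $\varepsilon^n$, a distinguished $0$-ary auxiliary relation is true after the changes if and only if the word then represented is in $L$. Let $\mathrm{UDyn}\Sigma_1$ be the class of languages over finite alphabets maintained by a program whose auxiliary relations are at most unary and whose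 update formulas are of the form $\exists z_1\cdots\exists z_k\,\psi$ with $\psi$ quantifier-free. Let $\mathrm{UDyn}\Sigma_1^+$ be defined in the same way with $\psi$ in addition positive, meaning that negation occurs only directly in front of atoms $z\le z'$. **The class $\mathbf J*\mathbf G$.** Let $\mathbf J$ be the class of piecewise testable languages, i.e. of Boolean combinations of languages $\Gamma^*a_1\Gamma^*\cdots\Gamma^*a_k\Gamma^*$ with $a_1,\dots,a_k\in\Gamma$, $\Gamma$ a finite alphabet; a finite monoid is said to be in $\mathbf J$ if every language over a finite alphabet that it recognizes is in $\mathbf J$. Let $\mathbf G$ be the class of finite groups. A finite monoid is in $\mathbf J*\mathbf G$ if it divides (is a quotient of a submonoid of) a semidirect product $M*N$, with respect to a left action of $N$ on $M$ by monoid endomorphisms and with multiplication $(x_1,y_1)(x_2,y_2)=(x_1\,(y_1\cdot x_2),\,y_1y_2)$, where $M\in\mathbf J$ and $N\in\mathbf G$. A regular language is in $\mathbf J*\mathbf G$ if its syntactic monoid is. **Statement.** Every regular language in $\mathbf J*\mathbf G$ is in $\mathrm{UDyn}\Sigma_1$. Moreover $\mathrm{UDyn}\Sigma_1$ strictly extends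 $\mathrm{UDyn}\Sigma_1^+$: every language in $\mathrm{UDyn}\Sigma_1^+$ is in $\mathrm{UDyn}\Sigma_1$, and some regular language is in $\mathrm{UDyn}\Sigma_1$ but not in $\mathrm{UDyn}\Sigma_1^+$. -/

import Mathlib

namespace DynReg

/-! ## Formulas over words with auxiliary relations -/

/-- The relation symbols describing a word over the alphabet `α`: a unary symbol `W_a` for every
letter `a`, and the binary symbol `≤`. -/
inductive WordRel (α : Type) : ℕ → Type
  | letter (a : α) : WordRel α 1
  | le : WordRel α 2

/-- The relational vocabulary of words over `α`. -/
def wordLang (α : Type) : FirstOrder.Language.{0, 0} where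
  Functions := fun _ => Empty
  Relations := WordRel α

/-- The word structure on the positions `0, …, n - 1`.  A position carries a letter or is empty;
the empty symbol `ε` is `none`. -/
@[reducible] def wordStructure {α : Type} {n : ℕ} (w : Fin n → Option α) :
    (wordLang α).Structure (Fin n) where
  funMap := fun f => Empty.elim f
  RelMap := fun R v =>
    match R, v with
    | WordRel.letter a, v => w (v 0) = some a
    | WordRel.le, v => v 0 ≤ v 1

/-- The word in `α*` spelled by `w`, i.e. its non-empty symbols from left to right. -/
def spell {α : Type} {n : ℕ} (w : Fin n → Option α) : List α :=
  (List.ofFn w).reduceOption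

/-- The vocabulary of update formulas: words together with the auxiliary symbols `τ`. -/
abbrev fullLang (α : Type) (τ : FirstOrder.Language.{0, 0}) : FirstOrder.Language.{0, 0} :=
  (wordLang α).sum τ

/-- Truth of a formula in the structure `(w, A)` formed by a word and auxiliary relations. -/
def holds {α : Type} {τ : FirstOrder.Language.{0, 0}} {n : ℕ} (w : Fin n → Option α)
    (A : τ.Structure (Fin n)) {β : Type} (φ : (fullLang α τ).Formula β) (v : β → Fin n) : Prop :=
  letI := wordStructure w
  letI := A
  φ.Realize v

/-! ## Dynamic programs -/

/-- A dynamic program over the alphabet `α`.  `init R` is the first-order formula that defines the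
initial value of `R` from the initial word.  `update σ R` is the update formula `φ_σ^R(x₁,…,x_r; y)`
for the change `set_σ(y)`; the variable `x_j` is `Sum.inl j` and `y` is `Sum.inr ()`. -/
structure DynProgram (α : Type) where
  aux : FirstOrder.Language.{0, 0}
  relational : aux.IsRelational
  finite : Finite (Σ r, aux.Relations r)
  init : ∀ {r : ℕ}, aux.Relations r → (wordLang α).Formula (Fin r)
  update : Option α → ∀ {r : ℕ}, aux.Relations r → (fullLang α aux).Formula (Fin r ⊕ Unit)
  answer : aux.Relations 0

namespace DynProgram

variable {α : Type} (D : DynProgram α)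

/-- The initial auxiliary relations, defined over the initial word, all of whose `n` positions
are empty. -/
@[reducible] def initAux (n : ℕ) : D.aux.Structure (Fin n) where
  funMap := fun {r} f => ((D.relational r).false f).elim
  RelMap := fun R v =>
    letI := wordStructure (fun _ : Fin n => (none : Option α))
    (D.init R).Realize v

/-- The effect of the change `set_σ(i)`: the symbol at `i` becomes `σ`, and every auxiliary relation
is redefined by its update formula, evaluated in the new word and the old auxiliary relations. -/
def step {n : ℕ} (s : (Fin n → Option α) × D.aux.Structure (Fin n)) (c : Option α × Fin n) :
    (Fin n → Option α) × D.aux.Structure (Fin n) :=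
  (Function.update s.1 c.2 c.1,
    { funMap := fun {r} f => ((D.relational r).false f).elim
      RelMap := fun R v =>
        holds (Function.update s.1 c.2 c.1) s.2 (D.update c.1 R) (Sum.elim v fun _ => c.2) })

/-- The word and the auxiliary relations after a sequence of changes `(σ, i)` of the empty word on
`n` positions. -/
def run (n : ℕ) (cs : List (Option α × Fin n)) :
    (Fin n → Option α) × D.aux.Structure (Fin n) :=
  cs.foldl D.step (fun _ => none, D.initAux n)

/-- The answer bit of a state. -/
def accepts {n : ℕ} (s : (Fin n → Option α) × D.aux.Structure (Fin n)) : Prop :=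
  letI := s.2
  FirstOrder.Language.Structure.RelMap D.answer (![] : Fin 0 → Fin n)

/-- `D` maintains the dynamic membership problem of `L`. -/
def Maintains (L : Language α) : Prop :=
  ∀ (n : ℕ) (cs : List (Option α × Fin n)),
    D.accepts (D.run n cs) ↔ spell (D.run n cs).1 ∈ L

/-- All auxiliary relations are at most unary. -/
def IsUnary : Prop :=
  ∀ r, 2 ≤ r → IsEmpty (D.aux.Relations r)

end DynProgram

/-! ## Classes of update formulas -/

/-- Formulas `∃ z₁ … ∃ z_k, ψ` whose matrix `ψ` satisfies `Q`. -/
inductive IsExPrenex {L : FirstOrder.Language.{0, 0}} {β : Type}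
    (Q : ∀ n : ℕ, L.BoundedFormula β n → Prop) : ∀ {n : ℕ}, L.BoundedFormula β n → Prop
  | matrix {n : ℕ} {φ : L.BoundedFormula β n} (h : Q n φ) : IsExPrenex Q φ
  | ex {n : ℕ} {φ : L.BoundedFormula β (n + 1)} (h : IsExPrenex Q φ) : IsExPrenex Q φ.ex

/-- Positive quantifier-free formulas: no negation, except directly in front of `≤`. -/
inductive IsPosQF {α : Type} {τ : FirstOrder.Language.{0, 0}} {β : Type} :
    ∀ {n : ℕ}, (fullLang α τ).BoundedFormula β n → Prop
  | top {n : ℕ} : IsPosQF (⊤ : (fullLang α τ).BoundedFormula β n)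
  | bot {n : ℕ} : IsPosQF (⊥ : (fullLang α τ).BoundedFormula β n)
  | of_isAtomic {n : ℕ} {φ : (fullLang α τ).BoundedFormula β n} (h : φ.IsAtomic) : IsPosQF φ
  | not_le {n : ℕ} (t₁ t₂ : (fullLang α τ).Term (β ⊕ Fin n)) :
      IsPosQF (FirstOrder.Language.Relations.boundedFormula₂
        (Sum.inl WordRel.le : (fullLang α τ).Relations 2) t₁ t₂).not
  | inf {n : ℕ} {φ ψ : (fullLang α τ).BoundedFormula β n} (hφ : IsPosQF φ) (hψ : IsPosQF ψ) :
      IsPosQF (φ ⊓ ψ)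
  | sup {n : ℕ} {φ ψ : (fullLang α τ).BoundedFormula β n} (hφ : IsPosQF φ) (hψ : IsPosQF ψ) :
      IsPosQF (φ ⊔ ψ)

/-- `Σ₁`: existential prenex formulas. -/
def IsSigma1 {L : FirstOrder.Language.{0, 0}} {β : Type} (φ : L.Formula β) : Prop :=
  IsExPrenex (fun _ ψ => ψ.IsQF) φ

/-- `Σ₁⁺`: existential prenex formulas with a positive matrix. -/
def IsSigma1Pos {α : Type} {τ : FirstOrder.Language.{0, 0}} {β : Type}
    (φ : (fullLang α τ).Formula β) : Prop :=
  IsExPrenex (fun _ ψ => IsPosQF ψ) φ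

/-- The membership problem of `L` is in `UDynΣ₁`. -/
def UDynSigma1 {α : Type} (L : Language α) : Prop :=
  ∃ D : DynProgram α, D.IsUnary ∧
    (∀ (σ : Option α) (r : ℕ) (R : D.aux.Relations r), IsSigma1 (D.update σ R)) ∧ D.Maintains L

/-- The membership problem of `L` is in `UDynΣ₁⁺`. -/
def UDynSigma1Pos {α : Type} (L : Language α) : Prop :=
  ∃ D : DynProgram α, D.IsUnary ∧
    (∀ (σ : Option α) (r : ℕ) (R : D.aux.Relations r), IsSigma1Pos (D.update σ R)) ∧ D.Maintains L

/-! ## Monoids and the wreath product of classes -/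

/-- The syntactic congruence of `L`: `u ∼ v` iff `x u y ∈ L ↔ x v y ∈ L` for all `x`, `y`. -/
def syntacticCon {α : Type} (L : Language α) : Con (FreeMonoid α) where
  r u v := ∀ x y : FreeMonoid α,
    (x * u * y).toList ∈ L ↔ (x * v * y).toList ∈ L
  iseqv :=
    { refl := fun _ _ _ => Iff.rfl
      symm := fun h x y => (h x y).symm
      trans := fun h₁ h₂ x y => (h₁ x y).trans (h₂ x y) }
  mul' := by
    intro u v u' v' h h' x y
    have h₁ := h x (u' * y)
    have h₂ := h' (x * v) y
    simp only [mul_assoc] at h₁ h₂ ⊢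
    exact h₁.trans h₂

/-- The syntactic monoid of `L`. -/
abbrev SyntacticMonoid {α : Type} (L : Language α) : Type := (syntacticCon L).Quotient

/-- `K` divides `M`: `K` is a quotient of a submonoid of `M`. -/
def Divides (K M : Type) [Monoid K] [Monoid M] : Prop :=
  ∃ (S : Submonoid M) (f : S →* K), Function.Surjective f

/-- The semidirect product `M ∗ N` with respect to a left action of the monoid `N` on `M` by monoid
endomorphisms. -/
@[ext]
structure Semidirect (M N : Type) where
  left : M
  right : N

instance (M N : Type) [Monoid M] [Monoid N] [MulDistribMulAction N M] :
    Monoid (Semidirect M N) where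
  mul a b := ⟨a.left * a.right • b.left, a.right * b.right⟩
  one := ⟨1, 1⟩
  mul_assoc a b c := by
    apply Semidirect.ext
    · change a.left * a.right • b.left * (a.right * b.right) • c.left
        = a.left * a.right • (b.left * b.right • c.left)
      rw [smul_mul', mul_smul, mul_assoc]
    · exact mul_assoc a.right b.right c.right
  one_mul a := by
    apply Semidirect.ext
    · change 1 * (1 : N) • a.left = a.left
      rw [one_smul, one_mul]
    · exact one_mul a.right
  mul_one a := by
    apply Semidirect.ext
    · change a.left * a.right • (1 : M) = a.left
      rw [smul_one, mul_one]
    · exact mul_one a.right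

/-- The wreath product `V ∗ W` of two classes of monoids: all monoids dividing a semidirect product
of a member of `V` and a member of `W`. -/
def WreathProduct (V W : (M : Type) → [Monoid M] → Prop) (K : Type) [Monoid K] : Prop :=
  ∃ (M N : Type) (_ : Monoid M) (_ : Monoid N) (_ : MulDistribMulAction N M),
    V M ∧ W N ∧ Divides K (Semidirect M N)

/-- Piecewise testable languages: Boolean combinations of languages
`Γ* a₁ Γ* ⋯ Γ* a_k Γ*`, i.e. of the sets of words with a given scattered subword `u`. -/
def PiecewiseTestable {Γ : Type} (L : Language Γ) : Prop :=
  (L : Set (List Γ)) ∈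
    BooleanSubalgebra.closure (Set.range fun u : List Γ => {w : List Γ | u.Sublist w})

/-- The class `J`, as a class of monoids: the finite monoids that recognize only piecewise testable
languages. -/
def ClassJ (M : Type) [Monoid M] : Prop :=
  Finite M ∧ ∀ (Γ : Type) [Finite Γ] (φ : FreeMonoid Γ →* M) (P : Set M),
    PiecewiseTestable {w : List Γ | φ (FreeMonoid.ofList w) ∈ P}

/-- The class `G` of finite groups. -/
def ClassG (N : Type) [Monoid N] : Prop :=
  Finite N ∧ ∀ x : N, ∃ y : N, x * y = 1 ∧ y * x = 1

/-- The regular languages in `J ∗ G`: those whose syntactic monoid is in `J ∗ G`. -/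
def InJG {α : Type} (L : Language α) : Prop :=
  WreathProduct ClassJ ClassG (SyntacticMonoid L)

end DynReg

namespace DynReg

/-! ## Positive formulas -/

/-! Upper bound. Lift the syntactic morphism letter by letter to a semidirect product of some `M` in
`J` and a finite group `N`. The `N`-component of a word is a product in `N`. Its `M`-component is
the image, under a fixed morphism, of the word in which each letter is paired with the product in
`N` of the letters before it (`annotHom_annot`). As `M` is in `J`, membership depends only on the
group value and on which words from a finite set `F` are subwords of this annotated word.

A change at `i` multiplies all later prefix products from the left by one common factor, computable
at `i` because `N` is a group (`prefixProd_update`). So prefix products, stored as unary relations,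
have quantifier-free updates. Membership is an arbitrary Boolean combination of subword conditions,
hence not `Σ₁` by itself. The program therefore looks one change ahead: for each `u` in `F` and
symbol `σ` it stores the positions at which setting `σ` would make `u` a subword. The answer is then
a Boolean combination of atoms, and only these relations need quantifiers, which guess an occurrence
of `u`.

Separation. The witness is the language of the empty word. Positive existential updates are
preserved along order embeddings that preserve letters and auxiliary relations. By Higman's lemma,
the state of some fully lettered word embeds into that of a longer one. Erasing the shorter word and
the image of its positions forces acceptance of a nonempty word. -/

theorem IsPosQF.isQF {α : Type} {τ : FirstOrder.Language.{0, 0}} {β : Type} {n : ℕ}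
    {φ : (fullLang α τ).BoundedFormula β n} (h : IsPosQF φ) : φ.IsQF := by
  induction h with
  | top => exact .top
  | bot => exact .falsum
  | of_isAtomic h => exact h.isQF
  | not_le t₁ t₂ => exact (FirstOrder.Language.BoundedFormula.IsAtomic.rel _ _).isQF.not
  | inf _ _ h₁ h₂ => exact h₁.inf h₂
  | sup _ _ h₁ h₂ => exact h₁.sup h₂

theorem IsExPrenex.mono {L : FirstOrder.Language.{0, 0}} {β : Type}
    {Q Q' : ∀ n : ℕ, L.BoundedFormula β n → Prop} (hQ : ∀ n φ, Q n φ → Q' n φ) {n : ℕ}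
    {φ : L.BoundedFormula β n} (h : IsExPrenex Q φ) : IsExPrenex Q' φ := by
  induction h with
  | matrix h => exact .matrix (hQ _ _ h)
  | ex _ ih => exact .ex ih

theorem UDynSigma1Pos.uDynSigma1 {α : Type} {L : Language α} (h : UDynSigma1Pos L) :
    UDynSigma1 L := by
  obtain ⟨D, hD, hφ, hL⟩ := h
  exact ⟨D, hD, fun σ r R => (hφ σ r R).mono fun _ _ h => h.isQF, hL⟩

/-! ### Monotonicity of positive existential updates along order embeddings. -/

section Monotone

variable {α : Type} {D : DynProgram α} {n m : ℕ}

/-- The order embedding `e` preserves all letters and all auxiliary relations. -/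
structure StateHom (e : Fin n ↪o Fin m) (s : (Fin n → Option α) × D.aux.Structure (Fin n))
    (t : (Fin m → Option α) × D.aux.Structure (Fin m)) : Prop where
  letter : ∀ i a, s.1 i = some a → t.1 (e i) = some a
  rel : ∀ {r : ℕ} (R : D.aux.Relations r) (v : Fin r → Fin n),
    s.2.RelMap R v → t.2.RelMap R (e ∘ v)

/-- An order embedding also reflects `≤`, so negated order atoms are harmless. Letters and auxiliary
relations are only preserved, so their negations would break the induction. -/
theorem StateHom.realize_posQF {e : Fin n ↪o Fin m} {w : Fin n → Option α}
    {A : D.aux.Structure (Fin n)} {w' : Fin m → Option α} {A' : D.aux.Structure (Fin m)}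
    (h : StateHom e (w, A) (w', A')) {β : Type} {k : ℕ}
    {φ : (fullLang α D.aux).BoundedFormula β k} (hφ : IsPosQF φ) (v : β → Fin n)
    (xs : Fin k → Fin n)
    (H : letI := wordStructure w; letI := A; φ.Realize v xs) :
    letI := wordStructure w'; letI := A'; φ.Realize (e ∘ v) (e ∘ xs) := by
  let := wordStructure w
  let := A
  let := wordStructure w'
  let := A'
  have hterm : ∀ {k : ℕ} (v : β → Fin n) (xs : Fin k → Fin n)
      (t : (fullLang α D.aux).Term (β ⊕ Fin k)),
      t.realize (Sum.elim (e ∘ v) (e ∘ xs)) = e (t.realize (Sum.elim v xs)) := by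
    intro k v xs t
    cases t with
    | var x => cases x <;> rfl
    | func f ts =>
      cases f with
      | inl f => exact Empty.elim f
      | inr f => exact ((D.relational _).false f).elim
  induction hφ with
  | top => exact FirstOrder.Language.BoundedFormula.realize_top.2 trivial
  | bot => exact H.elim
  | of_isAtomic hφ =>
    cases hφ with
    | equal t₁ t₂ =>
      rw [FirstOrder.Language.BoundedFormula.realize_bdEqual] at H ⊢
      rw [hterm, hterm, H]
    | rel R ts =>
      rw [FirstOrder.Language.BoundedFormula.realize_rel] at H ⊢
      simp only [hterm]
      cases R with
      | inl R =>
        cases R with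
        | letter a => exact h.letter _ a H
        | le => exact e.le_iff_le.2 H
      | inr R => exact h.rel R _ H
  | not_le t₁ t₂ =>
    rw [FirstOrder.Language.BoundedFormula.realize_not] at H ⊢
    refine fun H' => H ?_
    have H₁ := FirstOrder.Language.BoundedFormula.realize_rel₂.1 H'
    rw [hterm, hterm] at H₁
    exact FirstOrder.Language.BoundedFormula.realize_rel₂.2 (e.le_iff_le.1 H₁)
  | inf _ _ ih₁ ih₂ =>
    rw [FirstOrder.Language.BoundedFormula.realize_inf] at H ⊢
    exact ⟨ih₁ H.1, ih₂ H.2⟩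
  | sup _ _ ih₁ ih₂ =>
    rw [FirstOrder.Language.BoundedFormula.realize_sup] at H ⊢
    exact H.imp ih₁ ih₂

theorem StateHom.realize_exPrenex {e : Fin n ↪o Fin m} {w : Fin n → Option α}
    {A : D.aux.Structure (Fin n)} {w' : Fin m → Option α} {A' : D.aux.Structure (Fin m)}
    (h : StateHom e (w, A) (w', A')) {β : Type} {k : ℕ}
    {φ : (fullLang α D.aux).BoundedFormula β k} (hφ : IsExPrenex (fun _ ψ => IsPosQF ψ) φ)
    (v : β → Fin n) (xs : Fin k → Fin n)
    (H : letI := wordStructure w; letI := A; φ.Realize v xs) :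
    letI := wordStructure w'; letI := A'; φ.Realize (e ∘ v) (e ∘ xs) := by
  let := wordStructure w
  let := A
  let := wordStructure w'
  let := A'
  induction hφ with
  | matrix hφ => exact h.realize_posQF hφ v xs H
  | ex _ ih =>
    rw [FirstOrder.Language.BoundedFormula.realize_ex] at H ⊢
    obtain ⟨a, ha⟩ := H
    refine ⟨e a, ?_⟩
    have := ih _ ha
    rwa [Fin.comp_snoc] at this

/-- Injectivity of `e` ensures that the change at `e i` touches no other image position. Positions
outside the image play no role, since existential witnesses are only transported forwards. -/
theorem StateHom.step (hD : ∀ (σ : Option α) (r : ℕ) (R : D.aux.Relations r),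
      IsSigma1Pos (D.update σ R)) {e : Fin n ↪o Fin m}
    {s : (Fin n → Option α) × D.aux.Structure (Fin n)}
    {t : (Fin m → Option α) × D.aux.Structure (Fin m)} (h : StateHom e s t) (σ : Option α)
    (i : Fin n) : StateHom e (D.step s (σ, i)) (D.step t (σ, e i)) := by
  have hletter : ∀ j a, Function.update s.1 i σ j = some a →
      Function.update t.1 (e i) σ (e j) = some a := by
    intro j a hj
    by_cases hji : j = i
    · subst hji
      simpa using hj
    · rw [Function.update_of_ne hji] at hj
      rw [Function.update_of_ne (e.injective.ne hji)]
      exact h.letter j a hj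
  have h' : StateHom e (Function.update s.1 i σ, s.2) (Function.update t.1 (e i) σ, t.2) :=
    ⟨hletter, h.rel⟩
  refine ⟨hletter, fun {r} R v H => ?_⟩
  have := h'.realize_exPrenex (hD σ r R) _ _ H
  change holds _ _ _ _
  unfold holds FirstOrder.Language.Formula.Realize
  convert this using 1
  · ext x
    rcases x with x | x <;> rfl

theorem StateHom.foldl_step (hD : ∀ (σ : Option α) (r : ℕ) (R : D.aux.Relations r),
      IsSigma1Pos (D.update σ R)) {e : Fin n ↪o Fin m}
    (cs : List (Option α × Fin n)) {s : (Fin n → Option α) × D.aux.Structure (Fin n)}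
    {t : (Fin m → Option α) × D.aux.Structure (Fin m)} (h : StateHom e s t) :
    StateHom e (cs.foldl D.step s) ((cs.map fun c => (c.1, e c.2)).foldl D.step t) := by
  induction cs generalizing s t with
  | nil => exact h
  | cons c cs ih => exact ih (h.step hD c.1 c.2)

theorem StateHom.accepts {e : Fin n ↪o Fin m}
    {s : (Fin n → Option α) × D.aux.Structure (Fin n)}
    {t : (Fin m → Option α) × D.aux.Structure (Fin m)} (h : StateHom e s t)
    (hs : D.accepts s) : D.accepts t := by
  have := h.rel D.answer _ hs
  rwa [Subsingleton.elim (e ∘ ![]) ![]] at this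

end Monotone

/-! ### Embedding a state into a later one by Higman's lemma. -/

section HigmanEmbedding

variable {α : Type} {D : DynProgram α}

/-- The auxiliary relations that contain the constant tuple of a position. -/
def auxLabel {n : ℕ} (A : D.aux.Structure (Fin n)) (i : Fin n) :
    Set (Σ r, D.aux.Relations r) :=
  {R | A.RelMap R.2 fun _ => i}

/-- By Higman's lemma, some state of an infinite sequence embeds into a later one. -/
theorem exists_orderEmbedding_auxLabel (A : ∀ n : ℕ, D.aux.Structure (Fin n)) :
    ∃ n m : ℕ, n < m ∧ ∃ e : Fin (n + 1) ↪o Fin (m + 1),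
      ∀ i, auxLabel (A (n + 1)) i = auxLabel (A (m + 1)) (e i) := by
  have := D.finite
  have h := (Set.finite_univ (α := Set (Σ r, D.aux.Relations r))).partiallyWellOrderedOn
    (r := (· = ·)) |>.partiallyWellOrderedOn_sublistForall₂ (· = ·)
  -- Lengths `n + 1` guarantee a position, so that the labels also record the nullary relations.
  obtain ⟨n, m, hnm, hs⟩ := h fun n => ⟨List.ofFn (auxLabel (A (n + 1))), by simp⟩
  refine ⟨n, m, hnm, ?_⟩
  obtain ⟨l, hl, hs⟩ := List.sublistForall₂_iff.1 hs
  rw [List.forall₂_eq_eq_eq] at hl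
  subst hl
  rw [List.sublist_iff_exists_fin_orderEmbedding_get_eq] at hs
  obtain ⟨f, hf⟩ := hs
  refine ⟨((Fin.castOrderIso (by simp)).toOrderEmbedding.trans f).trans
    (Fin.castOrderIso (by simp)).toOrderEmbedding, fun i => ?_⟩
  have := hf (Fin.cast (by simp) i)
  simp only [List.get_ofFn] at this
  exact this

/-- Tuples of length at most one are constant, so the labels of single positions determine all
auxiliary relations. -/
theorem stateHom_of_auxLabel (hD : D.IsUnary) {n m : ℕ} {e : Fin (n + 1) ↪o Fin m}
    {s : (Fin (n + 1) → Option α) × D.aux.Structure (Fin (n + 1))}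
    {t : (Fin m → Option α) × D.aux.Structure (Fin m)}
    (hw : ∀ i a, s.1 i = some a → t.1 (e i) = some a)
    (h : ∀ i, auxLabel s.2 i = auxLabel t.2 (e i)) : StateHom e s t := by
  refine ⟨hw, fun {r} R v H => ?_⟩
  have key : ∃ i, v = fun _ => i := by
    rcases r with _ | _ | r
    · exact ⟨0, Subsingleton.elim _ _⟩
    · exact ⟨v 0, funext fun x => by rw [Fin.fin_one_eq_zero x]⟩
    · exact ((hD _ (by omega)).false R).elim
  obtain ⟨i, rfl⟩ := key
  have H' : (⟨r, R⟩ : Σ r, D.aux.Relations r) ∈ auxLabel s.2 i := H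
  rw [h i] at H'
  exact H'

end HigmanEmbedding

/-! ### The language of the empty word. -/

section EmptyWord

variable {α : Type} {D : DynProgram α}

theorem foldl_step_fst {n : ℕ} (σ : Option α) (l : List (Fin n))
    (s : (Fin n → Option α) × D.aux.Structure (Fin n)) (i : Fin n) :
    ((l.map fun j => (σ, j)).foldl D.step s).1 i = if i ∈ l then σ else s.1 i := by
  induction l generalizing s with
  | nil => simp
  | cons j l ih =>
    rw [List.map_cons, List.foldl_cons, ih]
    by_cases hi : i ∈ l
    · simp [hi]
    · by_cases hij : i = j
      · subst hij
        simp [hi, DynProgram.step]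
      · simp [hi, hij, DynProgram.step]

theorem spell_eq_nil_iff {n : ℕ} (w : Fin n → Option α) : spell w = [] ↔ ∀ i, w i = none := by
  rw [spell, List.reduceOption, List.filterMap_eq_nil_iff]
  simp [List.mem_ofFn]

/-- The language of the empty word cannot be maintained with positive update formulas. -/
theorem not_uDynSigma1Pos_one [Nonempty α] : ¬ UDynSigma1Pos (1 : Language α) := by
  rintro ⟨D, hU, hD, hL⟩
  obtain ⟨a⟩ := ‹Nonempty α›
  let full : ∀ n : ℕ, List (Option α × Fin n) := fun n =>
    (List.finRange n).map fun j => (some a, j)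
  have hfull : ∀ n i, (D.run n (full n)).1 i = some a := by
    intro n i
    rw [DynProgram.run, foldl_step_fst]
    simp
  obtain ⟨n, m, hnm, e, he⟩ := exists_orderEmbedding_auxLabel fun n => (D.run n (full n)).2
  have hom : StateHom e (D.run _ (full (n + 1))) (D.run _ (full (m + 1))) :=
    stateHom_of_auxLabel hU (fun i b hb => by rw [hfull] at hb ⊢; exact hb) he
  -- These changes erase the whole shorter word; their images under `e` erase only the range of `e`
  -- in the longer one.
  let cs : List (Option α × Fin (n + 1)) := (List.finRange (n + 1)).map fun j => (none, j)
  have hom' := hom.foldl_step hD cs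
  have hcs : cs.map (fun c => (c.1, e c.2)) =
      ((List.finRange (n + 1)).map e).map fun j => (none, j) := by
    simp [cs, Function.comp_def]
  have h₁ := hL (n + 1) (full (n + 1) ++ cs)
  have h₂ := hL (m + 1) (full (m + 1) ++ cs.map fun c => (c.1, e c.2))
  rw [Language.mem_one, spell_eq_nil_iff] at h₁ h₂
  have hrun : ∀ k c c', D.run k (c ++ c') = c'.foldl D.step (D.run k c) := fun k c c' =>
    List.foldl_append
  rw [hrun] at h₁ h₂
  have h₃ := h₂.1 (hom'.accepts (h₁.2 fun i => by rw [foldl_step_fst]; simp))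
  -- A position outside the range of `e` would still carry `a`, although the accepted word must be
  -- empty.
  have hsurj : Function.Surjective e := by
    intro i
    have := h₃ i
    rw [hcs, foldl_step_fst, hfull] at this
    by_contra hi
    push Not at hi
    simp [hi] at this
  have := Fintype.card_le_of_surjective _ hsurj
  simp at this
  omega

theorem isRegular_one : (1 : Language α).IsRegular := by
  -- State `true` means that nothing has been read; `false` is a sink.
  refine ⟨Bool, inferInstance, ⟨fun _ _ => false, true, {true}⟩, ?_⟩
  ext l
  rw [Language.mem_one, DFA.mem_accepts, DFA.eval, DFA.evalFrom]
  cases l with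
  | nil => simp
  | cons a l =>
    have : ∀ l : List α, l.foldl (fun (_ : Bool) _ => false) false = false := by
      intro l
      induction l with
      | nil => rfl
      | cons _ _ ih => exact ih
    simp [this]

end EmptyWord

/-! ## Building programs from semantic updates -/

/-! ### Closure properties of quantifier-free formulas. -/

section QuantifierFree

variable {L : FirstOrder.Language.{0, 0}} {β : Type} {k : ℕ}

theorem isQF_iSup {ι : Type} [Finite ι] {f : ι → L.BoundedFormula β k} (h : ∀ i, (f i).IsQF) :
    (FirstOrder.Language.BoundedFormula.iSup f).IsQF := by
  have key : ∀ l : List ι, ((l.map f).foldr (· ⊔ ·) ⊥).IsQF := by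
    intro l
    induction l with
    | nil => exact FirstOrder.Language.BoundedFormula.isQF_bot
    | cons i l ih => exact (h i).sup ih
  exact key _

theorem isQF_iInf {ι : Type} [Finite ι] {f : ι → L.BoundedFormula β k} (h : ∀ i, (f i).IsQF) :
    (FirstOrder.Language.BoundedFormula.iInf f).IsQF := by
  have key : ∀ l : List ι, ((l.map f).foldr (· ⊓ ·) ⊤).IsQF := by
    intro l
    induction l with
    | nil => exact FirstOrder.Language.BoundedFormula.IsQF.top
    | cons i l ih => exact (h i).inf ih
  exact key _

open Classical in
/-- Every Boolean combination of finitely many quantifier-free formulas is quantifier-free. -/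
theorem exists_isQF_realize_iff {ι : Type} [Finite ι] {ψ : ι → L.BoundedFormula β k}
    (hψ : ∀ i, (ψ i).IsQF) (B : Set ι → Prop) :
    ∃ χ : L.BoundedFormula β k, χ.IsQF ∧ ∀ (M : Type) [L.Structure M] (v : β → M)
      (xs : Fin k → M), χ.Realize v xs ↔ B {i | (ψ i).Realize v xs} := by
  -- Disjunctive normal form: one disjunct for each truth pattern `s` satisfying `B`.
  refine ⟨FirstOrder.Language.BoundedFormula.iSup fun s : {s : Set ι // B s} =>
    FirstOrder.Language.BoundedFormula.iInf fun i => if i ∈ s.1 then ψ i else (ψ i).not, ?_, ?_⟩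
  · refine isQF_iSup fun s => isQF_iInf fun i => ?_
    split_ifs
    · exact hψ i
    · exact (hψ i).not
  · intro M _ v xs
    rw [FirstOrder.Language.BoundedFormula.realize_iSup]
    simp only [FirstOrder.Language.BoundedFormula.realize_iInf]
    constructor
    · rintro ⟨⟨s, hs⟩, h⟩
      convert hs
      ext i
      have := h i
      by_cases hi : i ∈ s
      · simpa [hi] using this
      · simpa [hi] using this
    · intro h
      refine ⟨⟨_, h⟩, fun i => ?_⟩
      by_cases hi : (ψ i).Realize v xs
      · simp [hi]
      · simp [hi]

theorem isExPrenex_exs {Q : ∀ n : ℕ, L.BoundedFormula β n → Prop} :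
    ∀ {k : ℕ} {φ : L.BoundedFormula β k}, IsExPrenex Q φ → IsExPrenex Q φ.exs
  | 0, _, h => h
  | k + 1, φ, h => isExPrenex_exs (k := k) (φ := φ.ex) h.ex

end QuantifierFree

/-- Relation symbols of arity at most one. -/
inductive UnaryRel (Z U : Type) : ℕ → Type
  | nullary (z : Z) : UnaryRel Z U 0
  | unary (u : U) : UnaryRel Z U 1

/-- The relational language with nullary symbols `Z` and unary symbols `U`. -/
def unaryLang (Z U : Type) : FirstOrder.Language.{0, 0} where
  Functions := fun _ => Empty
  Relations := UnaryRel Z U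

theorem finite_unaryLang (Z U : Type) [Finite Z] [Finite U] :
    Finite (Σ r, (unaryLang Z U).Relations r) := by
  refine Finite.of_surjective (α := Z ⊕ U) (fun x => match x with
    | .inl z => ⟨0, .nullary z⟩
    | .inr u => ⟨1, .unary u⟩) ?_
  rintro ⟨_, z | u⟩
  · exact ⟨.inl z, rfl⟩
  · exact ⟨.inr u, rfl⟩

/-- The truth values of all atoms in the variables `V`. -/
structure AtomVal (α Z U V : Type) where
  letter : α → V → Prop
  le : V → V → Prop
  nullary : Z → Prop
  unary : U → V → Prop

/-- The truth values of the atoms under the assignment `v`. -/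
def atomVal {α Z U V : Type} {n : ℕ} (w : Fin n → Option α) (RZ : Z → Prop)
    (RU : U → Fin n → Prop) (v : V → Fin n) : AtomVal α Z U V where
  letter a x := w (v x) = some a
  le x y := v x ≤ v y
  nullary := RZ
  unary u x := RU u (v x)

/-- `A` interprets the nullary symbols by `RZ` and the unary symbols by `RU`. -/
def Interprets {Z U : Type} {n : ℕ} (A : (unaryLang Z U).Structure (Fin n)) (RZ : Z → Prop)
    (RU : U → Fin n → Prop) : Prop :=
  (∀ (z : Z) (v : Fin 0 → Fin n), A.RelMap (UnaryRel.nullary z) v ↔ RZ z) ∧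
    ∀ (u : U) (v : Fin 1 → Fin n), A.RelMap (UnaryRel.unary u) v ↔ RU u (v 0)

/-! ### Quantifier-free definability from truth values of atoms. -/

section Atoms

variable {α Z U V : Type} [Finite α] [Finite Z] [Finite U] [Finite V]

/-- The atomic formulas in the variables `f x`. -/
def atomFormula {β : Type} {k : ℕ} (f : V → β ⊕ Fin k) :
    (α × V) ⊕ (V × V) ⊕ Z ⊕ (U × V) → (fullLang α (unaryLang Z U)).BoundedFormula β k
  | .inl p => .rel (l := 1) (Sum.inl (WordRel.letter p.1)) fun _ => .var (f p.2)
  | .inr (.inl p) => .rel (l := 2) (Sum.inl WordRel.le) ![.var (f p.1), .var (f p.2)]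
  | .inr (.inr (.inl z)) => .rel (l := 0) (Sum.inr (UnaryRel.nullary z)) ![]
  | .inr (.inr (.inr p)) => .rel (l := 1) (Sum.inr (UnaryRel.unary p.1)) fun _ => .var (f p.2)

/-- Every property of the truth values of the atoms is defined by a quantifier-free formula. -/
theorem exists_isQF_realize_atomVal {β : Type} {k : ℕ} (f : V → β ⊕ Fin k)
    (B : AtomVal α Z U V → Prop) :
    ∃ χ : (fullLang α (unaryLang Z U)).BoundedFormula β k, χ.IsQF ∧
      ∀ (n : ℕ) (w : Fin n → Option α) (A : (unaryLang Z U).Structure (Fin n)) (RZ : Z → Prop)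
        (RU : U → Fin n → Prop), Interprets A RZ RU → ∀ (v : β → Fin n) (xs : Fin k → Fin n),
        (letI := wordStructure w; letI := A; χ.Realize v xs) ↔
          B (atomVal w RZ RU (Sum.elim v xs ∘ f)) := by
  obtain ⟨χ, hχ, h⟩ := exists_isQF_realize_iff
    (ψ := atomFormula (α := α) (Z := Z) (U := U) f)
    (fun i => by
      rcases i with _ | _ | _ | _ <;>
      exact (FirstOrder.Language.BoundedFormula.IsAtomic.rel _ _).isQF)
    (fun s => B ⟨fun a x => .inl (a, x) ∈ s, fun x y => .inr (.inl (x, y)) ∈ s,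
      fun z => .inr (.inr (.inl z)) ∈ s, fun u x => .inr (.inr (.inr (u, x))) ∈ s⟩)
  refine ⟨χ, hχ, fun n w A RZ RU hA v xs => ?_⟩
  let := wordStructure w
  let := A
  refine (h (Fin n) v xs).trans (iff_of_eq (congrArg B ?_))
  unfold atomVal
  congr 1
  · funext z
    exact propext (hA.1 z _)
  · funext u x
    exact propext (hA.2 u _)

end Atoms

open Classical in
/-- A language is in `UDynΣ₁` if it can be read off from nullary and unary relations on words that
have constant values on empty words and `Σ₁`-definable updates. -/
theorem uDynSigma1_of_relations {α : Type} [Finite α] (L : Language α) {Z U : Type} [Finite Z]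
    [Finite U] (relZ : ∀ {n : ℕ}, (Fin n → Option α) → Z → Prop)
    (relU : ∀ {n : ℕ}, (Fin n → Option α) → U → Fin n → Prop) (ans : Z)
    (initZ : Z → Prop) (initU : U → Prop)
    (hinitZ : ∀ n z, relZ (fun _ : Fin n => none) z ↔ initZ z)
    (hinitU : ∀ n u j, relU (fun _ : Fin n => none) u j ↔ initU u)
    (hZ : ∀ (σ : Option α) (z : Z), ∃ B : AtomVal α Z U Unit → Prop,
      ∀ (n : ℕ) (w : Fin n → Option α) (i : Fin n), relZ (Function.update w i σ) z ↔
        B (atomVal (Function.update w i σ) (relZ w) (relU w) fun _ => i))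
    (hU : ∀ (σ : Option α) (u : U), ∃ (k : ℕ) (B : AtomVal α Z U (Bool ⊕ Fin k) → Prop),
      ∀ (n : ℕ) (w : Fin n → Option α) (i j : Fin n), relU (Function.update w i σ) u j ↔
        ∃ xs : Fin k → Fin n, B (atomVal (Function.update w i σ) (relZ w) (relU w)
          (Sum.elim (fun b => cond b i j) xs)))
    (hans : ∀ (n : ℕ) (w : Fin n → Option α), relZ w ans ↔ spell w ∈ L) : UDynSigma1 L := by
  have key : ∀ (σ : Option α) (r : ℕ) (R : UnaryRel Z U r),
      ∃ φ : (fullLang α (unaryLang Z U)).Formula (Fin r ⊕ Unit), IsSigma1 φ ∧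
        ∀ (n : ℕ) (w : Fin n → Option α) (A : (unaryLang Z U).Structure (Fin n)),
        Interprets A (relZ w) (relU w) → ∀ (i : Fin n) (v : Fin r → Fin n),
        holds (Function.update w i σ) A φ (Sum.elim v fun _ => i) ↔
          match r, R, v with
          | _, .nullary z, _ => relZ (Function.update w i σ) z
          | _, .unary u, v => relU (Function.update w i σ) u (v 0) := by
    intro σ r R
    cases R with
    | nullary z =>
      obtain ⟨B, hB⟩ := hZ σ z
      obtain ⟨χ, hχ, h⟩ := exists_isQF_realize_atomVal (β := Fin 0 ⊕ Unit) (k := 0)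
        (fun _ : Unit => .inl (.inr ())) B
      refine ⟨χ, .matrix hχ, fun n w A hA i v => ?_⟩
      exact (h n (Function.update w i σ) A _ _ hA _ _).trans (hB n w i).symm
    | unary u =>
      obtain ⟨k, B, hB⟩ := hU σ u
      obtain ⟨χ, hχ, h⟩ := exists_isQF_realize_atomVal (β := Fin 1 ⊕ Unit) (k := k)
        -- The variable `true` stands for the changed position, `false` for the argument of the
        -- relation.
        (Sum.map (fun b : Bool => cond b (.inr ()) (.inl 0)) id) B
      refine ⟨χ.exs, isExPrenex_exs (.matrix hχ), fun n w A hA i v => ?_⟩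
      let := wordStructure (Function.update w i σ)
      let := A
      refine FirstOrder.Language.BoundedFormula.realize_exs.trans ?_
      refine (exists_congr fun xs => ?_).trans (hB n w i (v 0)).symm
      rw [h n (Function.update w i σ) A _ _ hA]
      refine iff_of_eq (congrArg (fun f => B (atomVal _ _ _ f)) ?_)
      funext x
      rcases x with (_ | _) | x <;> rfl
  choose φ hφ hφ' using key
  let D : DynProgram α :=
    { aux := unaryLang Z U
      relational := fun _ => inferInstanceAs (IsEmpty Empty)
      finite := finite_unaryLang Z U
      init := fun R => match R with
        | .nullary z => if initZ z then ⊤ else ⊥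
        | .unary u => if initU u then ⊤ else ⊥
      update := fun σ {r} R => φ σ r R
      answer := UnaryRel.nullary ans }
  -- Invariant: after any changes the stored relations have their intended values on the current
  -- word.
  have hrun : ∀ (n : ℕ) (cs : List (Option α × Fin n)),
      Interprets (D.run n cs).2 (relZ (D.run n cs).1) (relU (D.run n cs).1) := by
    intro n cs
    induction cs using List.reverseRecOn with
    | nil =>
      let := wordStructure (fun _ : Fin n => (none : Option α))
      constructor
      · intro z v
        refine Iff.trans ?_ (hinitZ n z).symm
        change (if initZ z then ⊤ else ⊥ : (wordLang α).Formula (Fin 0)).Realize v ↔ _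
        split_ifs with h <;> simp [h]
      · intro u v
        refine Iff.trans ?_ (hinitU n u (v 0)).symm
        change (if initU u then ⊤ else ⊥ : (wordLang α).Formula (Fin 1)).Realize v ↔ _
        split_ifs with h <;> simp [h]
    | append_singleton cs c ih =>
      have h : D.run n (cs ++ [c]) = D.step (D.run n cs) c := by
        simp [DynProgram.run]
      rw [h]
      exact ⟨fun z v => hφ' c.1 0 (.nullary z) n _ _ ih c.2 v,
        fun u v => hφ' c.1 1 (.unary u) n _ _ ih c.2 v⟩
  refine ⟨D, ?_, fun σ r R => hφ σ r R, fun n cs => ?_⟩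
  · intro r hr
    refine ⟨fun R => ?_⟩
    rcases (show UnaryRel Z U r from R) with _ | _ <;> omega
  · exact ((hrun n cs).1 ans _).trans (hans n _)

open scoped List

/-! ## Prefix products -/

section Prefix

variable {α N : Type} [Monoid N] (y : α → N)

/-- The product of the first `k` symbols; empty symbols count as `1`. -/
def prefixProd (f : ℕ → Option α) : ℕ → N
  | 0 => 1
  | k + 1 => prefixProd f k * (f k).elim 1 y

variable {y} in
-- For `k > i` the segment from `i + 1` to `k` is unchanged, and its product is the inverse of the
-- old product up to `i` inclusive times the old `k`-th prefix product. So the correcting factor on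
-- the left does not depend on `k`.
theorem prefixProd_update {inv : N → N} (hinv : ∀ x, inv x * x = 1) (f : ℕ → Option α) (i : ℕ)
    (σ : Option α) (k : ℕ) :
    prefixProd y (Function.update f i σ) k = if k ≤ i then prefixProd y f k else
      prefixProd y f i * σ.elim 1 y * inv (prefixProd y f (i + 1)) * prefixProd y f k := by
  induction k with
  | zero => simp [prefixProd]
  | succ k ih =>
    rw [prefixProd, ih]
    rcases lt_trichotomy k i with h | h | h
    · rw [if_pos h.le, if_pos (Nat.succ_le_of_lt h), Function.update_of_ne h.ne, prefixProd]
    · subst h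
      rw [if_pos le_rfl, if_neg (by omega), Function.update_self, mul_assoc _ (inv _), hinv,
        mul_one]
    · rw [if_neg (by omega), if_neg (by omega), Function.update_of_ne h.ne', prefixProd.eq_2 y f k]
      simp only [mul_assoc]

/-- The letters of a word, each paired with `g` times the product of the letters before it. -/
def annot : N → List α → List (N × α)
  | _, [] => []
  | g, a :: l => (g, a) :: annot (g * y a) l

theorem annot_append (g : N) (l l' : List α) :
    annot y g (l ++ l') = annot y g l ++ annot y (g * (l.map y).prod) l' := by
  induction l generalizing g with
  | nil => simp [annot]
  | cons a l ih => simp [annot, ih, mul_assoc]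

/-- The symbol at a position, with empty symbols outside the domain. -/
def symbolAt {n : ℕ} (w : Fin n → Option α) (k : ℕ) : Option α :=
  if h : k < n then w ⟨k, h⟩ else none

theorem symbolAt_val {n : ℕ} (w : Fin n → Option α) (i : Fin n) : symbolAt w i = w i := by
  simp [symbolAt]

theorem symbolAt_update {n : ℕ} (w : Fin n → Option α) (i : Fin n) (σ : Option α) :
    symbolAt (Function.update w i σ) = Function.update (symbolAt w) i σ := by
  funext k
  by_cases hk : k = i
  · subst hk
    simp [symbolAt]
  · rw [Function.update_of_ne hk]
    unfold symbolAt
    split_ifs with h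
    · rw [Function.update_of_ne (fun h' => hk (by rw [← h']))]
    · rfl

theorem spell_eq {n : ℕ} (w : Fin n → Option α) :
    spell w = (List.range n).filterMap (symbolAt w) := by
  have : List.ofFn w = (List.range n).map (symbolAt w) := by
    apply List.ext_getElem
    · simp
    · intro i h₁ h₂
      simp [symbolAt, show i < n by simpa using h₁]
  rw [spell, this, List.reduceOption, List.filterMap_map]
  rfl

theorem prod_filterMap (f : ℕ → Option α) (k : ℕ) :
    (((List.range k).filterMap f).map y).prod = prefixProd y f k := by
  induction k with
  | zero => rfl
  | succ k ih =>
    rw [List.range_succ, List.filterMap_append, List.map_append, List.prod_append, ih, prefixProd]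
    cases h : f k <;> simp [h]

theorem annot_filterMap (f : ℕ → Option α) (k : ℕ) :
    annot y 1 ((List.range k).filterMap f) =
      (List.range k).filterMap fun i => (f i).map (prefixProd y f i, ·) := by
  induction k with
  | zero => rfl
  | succ k ih =>
    rw [List.range_succ, List.filterMap_append, annot_append, prod_filterMap, ih,
      List.filterMap_append, one_mul]
    cases h : f k <;> simp [h, annot]

theorem sublist_filterMap_iff_map {β γ : Type} (f : β → Option γ) (u : List γ) (l : List β) :
    u <+ l.filterMap f ↔ u.map some <+ l.map f := by
  rw [List.sublist_filterMap_iff, List.sublist_map_iff]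
  constructor
  · rintro ⟨l', hl', rfl⟩
    refine ⟨l'.filter fun x => (f x).isSome, List.filter_sublist.trans hl', ?_⟩
    clear hl'
    induction l' with
    | nil => rfl
    | cons b l' ih => cases h : f b <;> simp [h, ih]
  · rintro ⟨l', hl', h⟩
    refine ⟨l', hl', ?_⟩
    have := congrArg (List.filterMap id) h
    simpa [List.filterMap_map] using this

/-- An occurrence of a subword is an increasing tuple of positions. Strict order is phrased as a
negated `≤` because `≤` is the available atom. -/
theorem sublist_filterMap_range_iff {γ : Type} (f : ℕ → Option γ) (u : List γ) (n : ℕ) :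
    u <+ (List.range n).filterMap f ↔ ∃ xs : Fin u.length → Fin n,
      (∀ a b, a < b → ¬ xs b ≤ xs a) ∧ ∀ a, f (xs a) = some (u.get a) := by
  rw [sublist_filterMap_iff_map, List.sublist_iff_exists_fin_orderEmbedding_get_eq]
  constructor
  · rintro ⟨e, he⟩
    refine ⟨fun a => Fin.cast (by simp) (e (Fin.cast (by simp) a)), fun a b hab => ?_,
      fun a => ?_⟩
    · rw [not_le]
      exact e.strictMono (show Fin.cast _ a < Fin.cast _ b from hab)
    · have := he (Fin.cast (by simp) a)
      simp at this
      simp [this]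
  · rintro ⟨xs, hxs, h⟩
    have hmono : StrictMono xs := fun a b hab => not_le.1 (hxs a b hab)
    refine ⟨((Fin.castOrderIso (by simp)).toOrderEmbedding.trans
      (OrderEmbedding.ofStrictMono xs hmono)).trans
      (Fin.castOrderIso (by simp)).toOrderEmbedding, fun a => ?_⟩
    have := h (Fin.cast (by simp) a)
    simp at this
    simp [this]

theorem sublist_annot_spell_iff {n : ℕ} (w : Fin n → Option α) (u : List (N × α)) :
    u <+ annot y 1 (spell w) ↔ ∃ xs : Fin u.length → Fin n,
      (∀ a b, a < b → ¬ xs b ≤ xs a) ∧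
        ∀ a, prefixProd y (symbolAt w) (xs a) = (u.get a).1 ∧ w (xs a) = some (u.get a).2 := by
  rw [spell_eq, annot_filterMap, sublist_filterMap_range_iff]
  refine exists_congr fun xs => and_congr_right fun _ => forall_congr' fun a => ?_
  rw [symbolAt_val, Option.map_eq_some_iff]
  constructor
  · rintro ⟨b, hb, h⟩
    rw [← h]
    exact ⟨rfl, hb⟩
  · rintro ⟨h₁, h₂⟩
    exact ⟨_, h₂, by rw [h₁]⟩

theorem prod_spell {n : ℕ} (w : Fin n → Option α) :
    ((spell w).map y).prod = prefixProd y (symbolAt w) n := by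
  rw [spell_eq, prod_filterMap]

theorem symbolAt_none (n : ℕ) : symbolAt (fun _ : Fin n => (none : Option α)) = fun _ => none := by
  funext k
  simp [symbolAt]

theorem prefixProd_none (k : ℕ) : prefixProd y (fun _ => none) k = 1 := by
  induction k with
  | zero => rfl
  | succ k ih => simp [prefixProd, ih]

theorem spell_none (n : ℕ) : spell (fun _ : Fin n => (none : Option α)) = [] := by
  rw [spell_eq_nil_iff]
  exact fun _ => rfl

/-- Shows that the initial values of the look-ahead relations do not depend on the position. -/
theorem spell_update_none {n : ℕ} (j : Fin n) (σ : Option α) :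
    spell (Function.update (fun _ : Fin n => (none : Option α)) j σ) = σ.toList := by
  rw [spell_eq, symbolAt_update, symbolAt_none]
  have : ∀ k : ℕ, (List.range k).filterMap (Function.update (fun _ => none) (j : ℕ) σ) =
      if (j : ℕ) < k then σ.toList else [] := by
    intro k
    induction k with
    | zero => rfl
    | succ k ih =>
      rw [List.range_succ, List.filterMap_append, ih]
      rcases lt_trichotomy (j : ℕ) k with h | h | h
      · rw [if_pos h, if_pos (by omega)]
        simp [Function.update_of_ne h.ne']
      · rw [if_neg (by omega), if_pos (by omega), ← h]
        cases σ <;> simp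
      · rw [if_neg (by omega), if_neg (by omega)]
        simp [Function.update_of_ne h.ne]
  rw [this, if_pos j.2]

end Prefix

/-! ## Languages determined by subwords of annotated words -/

section Core

variable {α N : Type} [Monoid N] {y : α → N} {F : Set (List (N × α))} {V : Type}

/-- The nullary symbols: the product of the whole word, and the answer. -/
abbrev CoreZ (N : Type) : Type := Option N

/-- The unary symbols: the product strictly before and up to a position, and the subwords in `F` of
the annotated word that results from a change of the symbol at a position. -/
abbrev CoreU {α N : Type} (F : Set (List (N × α))) : Type := (N ⊕ N) ⊕ (F × Option α)

/-- The intended values of the nullary symbols. -/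
def coreRelZ (y : α → N) (L : Language α) {n : ℕ} (w : Fin n → Option α) : CoreZ N → Prop
  | some g => prefixProd y (symbolAt w) n = g
  | none => spell w ∈ L

/-- The intended values of the unary symbols. -/
def coreRelU (y : α → N) (F : Set (List (N × α))) {n : ℕ} (w : Fin n → Option α) :
    CoreU F → Fin n → Prop
  | .inl (.inl g), i => prefixProd y (symbolAt w) i = g
  | .inl (.inr g), i => prefixProd y (symbolAt w) (i + 1) = g
  | .inr (u, σ), j => u.1 <+ annot y 1 (spell (Function.update w j σ))

namespace AtomVal

/-- The product before a position, read off from the atoms. -/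
noncomputable def pre (t : AtomVal α (CoreZ N) (CoreU F) V) (x : V) : N :=
  Classical.epsilon fun g => t.unary (.inl (.inl g)) x

/-- The product up to a position, read off from the atoms. -/
noncomputable def post (t : AtomVal α (CoreZ N) (CoreU F) V) (x : V) : N :=
  Classical.epsilon fun g => t.unary (.inl (.inr g)) x

/-- The product of the word, read off from the atoms. -/
noncomputable def total (t : AtomVal α (CoreZ N) (CoreU F) V) : N :=
  Classical.epsilon fun g => t.nullary (some g)

/-- The factor by which a change at `i` multiplies the later prefix products. -/
noncomputable def factor (y : α → N) (inv : N → N) (t : AtomVal α (CoreZ N) (CoreU F) V)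
    (σ : Option α) (i : V) : N :=
  t.pre i * σ.elim 1 y * inv (t.post i)

open Classical in
/-- The product before `x` after a change at `i`. -/
noncomputable def newPre (y : α → N) (inv : N → N) (t : AtomVal α (CoreZ N) (CoreU F) V)
    (σ : Option α) (i x : V) : N :=
  if t.le x i then t.pre x else t.factor y inv σ i * t.pre x

open Classical in
/-- The product up to `x` after a change at `i`. -/
noncomputable def newPost (y : α → N) (inv : N → N) (t : AtomVal α (CoreZ N) (CoreU F) V)
    (σ : Option α) (i x : V) : N :=
  if t.le i x then t.factor y inv σ i * t.post x else t.post x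

open Classical in
/-- The product before `x` after changes at `i` and at `j`. -/
noncomputable def newPre₂ (y : α → N) (inv : N → N) (t : AtomVal α (CoreZ N) (CoreU F) V)
    (σ : Option α) (i : V) (σ' : Option α) (j x : V) : N :=
  if t.le x j then t.newPre y inv σ i x else
    t.newPre y inv σ i j * σ'.elim 1 y * inv (t.newPost y inv σ i j) * t.newPre y inv σ i x

end AtomVal

/-- Of the relations indexed by possible products exactly one holds, so choice recovers the stored
product. -/
theorem epsilon_eq {γ : Type} (a : γ) : (@Classical.epsilon γ ⟨a⟩ fun g => a = g) = a :=
  (@Classical.epsilon_spec γ (fun g => a = g) ⟨a, rfl⟩).symm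

variable {n : ℕ} {w w' : Fin n → Option α} {L : Language α} {v : V → Fin n}

/-- The structure combines a word `w'` with relations belonging to `w`, because updates read the new
word together with the old relations. -/
theorem pre_atomVal (x : V) :
    (atomVal w' (coreRelZ y L w) (coreRelU y F w) v).pre x = prefixProd y (symbolAt w) (v x) :=
  epsilon_eq _

theorem post_atomVal (x : V) :
    (atomVal w' (coreRelZ y L w) (coreRelU y F w) v).post x =
      prefixProd y (symbolAt w) (v x + 1) :=
  epsilon_eq _

theorem total_atomVal :
    (atomVal w' (coreRelZ y L w) (coreRelU y F w) v).total = prefixProd y (symbolAt w) n :=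
  epsilon_eq _

theorem newPre_atomVal {inv : N → N} (hinv : ∀ x, inv x * x = 1)
    (σ : Option α) (i x : V) :
    (atomVal w' (coreRelZ y L w) (coreRelU y F w) v).newPre y inv σ i x =
      prefixProd y (symbolAt (Function.update w (v i) σ)) (v x) := by
  rw [symbolAt_update, prefixProd_update hinv, AtomVal.newPre, AtomVal.factor, pre_atomVal,
    pre_atomVal, post_atomVal]
  classical exact if_congr Iff.rfl rfl rfl

theorem newPost_atomVal {inv : N → N} (hinv : ∀ x, inv x * x = 1)
    (σ : Option α) (i x : V) :
    (atomVal w' (coreRelZ y L w) (coreRelU y F w) v).newPost y inv σ i x =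
      prefixProd y (symbolAt (Function.update w (v i) σ)) (v x + 1) := by
  rw [symbolAt_update, prefixProd_update hinv, AtomVal.newPost, AtomVal.factor, pre_atomVal,
    post_atomVal, post_atomVal]
  -- The branches are swapped: `i ≤ x` is the negation of `x + 1 ≤ i`.
  split_ifs with h₁ h₂ h₂
  · have : (v i : ℕ) ≤ v x := h₁
    omega
  · rfl
  · rfl
  · have : ¬ (v i : ℕ) ≤ v x := h₁
    omega

theorem factor_mul_total_atomVal {inv : N → N} (hinv : ∀ x, inv x * x = 1)
    (σ : Option α) (i : V) :
    (atomVal w' (coreRelZ y L w) (coreRelU y F w) v).factor y inv σ i *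
        (atomVal w' (coreRelZ y L w) (coreRelU y F w) v).total =
      prefixProd y (symbolAt (Function.update w (v i) σ)) n := by
  rw [symbolAt_update, prefixProd_update hinv, AtomVal.factor, pre_atomVal, post_atomVal,
    total_atomVal, if_neg (by have := (v i).2; omega)]

/-- The one-change rule is applied twice, the second time with the products at `j` already corrected
for the change at `i`. -/
theorem newPre₂_atomVal {inv : N → N} (hinv : ∀ x, inv x * x = 1)
    (σ : Option α) (i : V) (σ' : Option α) (j x : V) :
    (atomVal w' (coreRelZ y L w) (coreRelU y F w) v).newPre₂ y inv σ i σ' j x =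
      prefixProd y (symbolAt (Function.update (Function.update w (v i) σ) (v j) σ')) (v x) := by
  rw [symbolAt_update (Function.update w (v i) σ), prefixProd_update hinv, AtomVal.newPre₂,
    newPre_atomVal hinv, newPre_atomVal hinv, newPost_atomVal hinv]
  classical exact if_congr Iff.rfl rfl rfl

/-- A language is in `UDynΣ₁` if membership depends on the value of a word in a finite group and
on finitely many subwords of the word annotated with its prefix values. -/
theorem uDynSigma1_of_annot [Finite α] [Finite N] {inv : N → N} (hinv : ∀ x, inv x * x = 1)
    (hF : F.Finite) (C : Set F → N → Prop)
    (hL : ∀ l : List α, l ∈ L ↔ C {u | u.1 <+ annot y 1 l} (l.map y).prod) :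
    UDynSigma1 L := by
  have := hF.to_subtype
  refine uDynSigma1_of_relations (Z := CoreZ N) (U := CoreU F) L (fun w => coreRelZ y L w)
    (fun w => coreRelU y F w) none
    (fun z => z.elim ([] ∈ L) fun g => 1 = g)
    (fun u => match u with
      | .inl (.inl g) => 1 = g
      | .inl (.inr g) => 1 = g
      | .inr (u, σ) => u.1 <+ annot y 1 σ.toList) ?_ ?_ ?_ ?_ fun n w => Iff.rfl
  · rintro n (_ | g)
    · change spell _ ∈ L ↔ _
      rw [spell_none]
      rfl
    · change prefixProd _ _ _ = _ ↔ _
      rw [symbolAt_none, prefixProd_none]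
      rfl
  · rintro n ((g | g) | ⟨u, σ⟩) j
    · change prefixProd _ _ _ = _ ↔ _
      rw [symbolAt_none, prefixProd_none]
    · change prefixProd _ _ _ = _ ↔ _
      rw [symbolAt_none, prefixProd_none]
    · change u.1 <+ _ ↔ _
      rw [spell_update_none]
  · rintro σ (_ | g)
    -- The old look-ahead relation for `(u, σ)` at `i` already describes the word after this change,
    -- so even an arbitrary `C` needs no quantifier.
    · refine ⟨fun t => C {u | t.unary (.inr (u, σ)) ()} (t.factor y inv σ () * t.total),
        fun n w i => ?_⟩
      change spell _ ∈ L ↔ _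
      beta_reduce
      rw [factor_mul_total_atomVal hinv, hL, prod_spell]
      rfl
    · refine ⟨fun t => t.factor y inv σ () * t.total = g, fun n w i => ?_⟩
      beta_reduce
      rw [factor_mul_total_atomVal hinv]
      rfl
  · rintro σ ((g | g) | ⟨u, σ'⟩)
    · refine ⟨0, fun t => t.newPre y inv σ (.inl true) (.inl false) = g, fun n w i j => ?_⟩
      simp only [newPre_atomVal hinv]
      exact (exists_const (Fin 0 → Fin n)).symm
    · refine ⟨0, fun t => t.newPost y inv σ (.inl true) (.inl false) = g, fun n w i j => ?_⟩
      simp only [newPost_atomVal hinv]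
      exact (exists_const (Fin 0 → Fin n)).symm
    -- One quantifier per letter of `u`. The occurrence must exist after the actual change at `i`
    -- and the hypothetical one at `j`: a guessed position equal to `j` carries `σ'`, any other its
    -- letter in the new word. Equality is written as two `≤` atoms.
    · refine ⟨u.1.length, fun t => (∀ a b, a < b → ¬ t.le (.inr b) (.inr a)) ∧
        ∀ a, t.newPre₂ y inv σ (.inl true) σ' (.inl false) (.inr a) = (u.1.get a).1 ∧
          (t.le (.inr a) (.inl false) ∧ t.le (.inl false) (.inr a) ∧ σ' = some (u.1.get a).2 ∨
            ¬ (t.le (.inr a) (.inl false) ∧ t.le (.inl false) (.inr a)) ∧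
              t.letter (u.1.get a).2 (.inr a)), fun n w i j => ?_⟩
      change u.1 <+ _ ↔ _
      rw [sublist_annot_spell_iff]
      refine exists_congr fun xs => and_congr Iff.rfl (forall_congr' fun a => ?_)
      rw [newPre₂_atomVal hinv]
      refine and_congr Iff.rfl ?_
      change _ ↔ xs a ≤ j ∧ j ≤ xs a ∧ _ ∨
        ¬ (xs a ≤ j ∧ j ≤ xs a) ∧ Function.update w i σ (xs a) = _
      rw [← and_assoc, ← le_antisymm_iff]
      by_cases h : xs a = j
      · simp [h]
      · simp [h]

end Core

/-! ## Languages in `J ∗ G` -/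

/-- A generator depends on a single subword, and Boolean operations at most unite the finite sets of
relevant subwords. -/
theorem PiecewiseTestable.exists_finite {Γ : Type} {L : Language Γ} (h : PiecewiseTestable L) :
    ∃ F : Set (List Γ), F.Finite ∧
      ∀ w w' : List Γ, (∀ u ∈ F, u <+ w ↔ u <+ w') → (w ∈ L ↔ w' ∈ L) := by
  unfold PiecewiseTestable at h
  induction h using BooleanSubalgebra.closure_bot_sup_induction with
  | mem x hx =>
    obtain ⟨u, rfl⟩ := hx
    exact ⟨{u}, Set.finite_singleton u, fun w w' h => h u rfl⟩
  | bot => exact ⟨∅, Set.finite_empty, fun _ _ _ => Iff.rfl⟩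
  | sup x _ y _ hx hy =>
    obtain ⟨F, hF, h⟩ := hx
    obtain ⟨F', hF', h'⟩ := hy
    exact ⟨F ∪ F', hF.union hF', fun w w' H =>
      or_congr (h w w' fun u hu => H u (.inl hu)) (h' w w' fun u hu => H u (.inr hu))⟩
  | compl x _ hx =>
    obtain ⟨F, hF, h⟩ := hx
    exact ⟨F, hF, fun w w' H => not_congr (h w w' H)⟩

/-! ### Words evaluated in a semidirect product. -/

section Semidirect

variable {α M N : Type} [Monoid M] [Monoid N] [MulDistribMulAction N M]

theorem Semidirect.mul_left (a b : Semidirect M N) : (a * b).left = a.left * a.right • b.left :=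
  rfl

theorem Semidirect.mul_right (a b : Semidirect M N) : (a * b).right = a.right * b.right :=
  rfl

/-- The value of an annotated word in `M`. -/
def annotHom (x : α → M) : FreeMonoid (N × α) →* M :=
  FreeMonoid.lift fun p => p.1 • x p.2

/-- Unfolding a product in `M ∗ N`, the left component of each letter is acted on by the product of
the right components before it. The general start value `g` lets the induction pass to the tail. -/
theorem annotHom_annot (s : α → Semidirect M N) (g : N) (l : List α) :
    annotHom (fun a => (s a).left) (FreeMonoid.ofList (annot (fun a => (s a).right) g l)) =
      g • ((l.map s).prod).left := by
  induction l generalizing g with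
  | nil => exact (smul_one g).symm
  | cons a l ih =>
    rw [annot, FreeMonoid.ofList_cons, map_mul, ih, List.map_cons, List.prod_cons,
      Semidirect.mul_left, smul_mul', mul_smul]
    rfl

theorem prod_map_right (s : α → Semidirect M N) (l : List α) :
    ((l.map s).prod).right = (l.map fun a => (s a).right).prod := by
  induction l with
  | nil => rfl
  | cons a l ih => rw [List.map_cons, List.prod_cons, Semidirect.mul_right, ih]; simp

end Semidirect

/-- The class of a word in the syntactic monoid decides membership. -/
theorem mem_iff_of_syntacticCon {α : Type} {L : Language α} {l l' : FreeMonoid α}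
    (h : (syntacticCon L).mk' l = (syntacticCon L).mk' l') : l.toList ∈ L ↔ l'.toList ∈ L := by
  have := (Con.eq _).1 h 1 1
  simpa using this

/-- Every language whose syntactic monoid is in `J ∗ G` is in `UDynΣ₁`. -/
theorem InJG.uDynSigma1 {α : Type} [Finite α] {L : Language α} (h : InJG L) : UDynSigma1 L := by
  obtain ⟨M, N, _, _, _, ⟨-, hM⟩, ⟨_, hN⟩, S, f, hf⟩ := h
  choose inv hinv using fun x : N => hN x
  choose s hs using fun a : α => hf ((syntacticCon L).mk' (FreeMonoid.of a))
  have hword : ∀ l : List α,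
      f (l.map s).prod = (syntacticCon L).mk' (FreeMonoid.ofList l) := by
    intro l
    induction l with
    | nil => simp
    | cons a l ih =>
      rw [List.map_cons, List.prod_cons, map_mul, ih, hs, FreeMonoid.ofList_cons, map_mul]
  let s' : α → Semidirect M N := fun a => s a
  have hcoe : ∀ l : List α, ((l.map s).prod : Semidirect M N) = (l.map s').prod := by
    intro l
    rw [Submonoid.coe_list_prod, List.map_map]
    rfl
  let φ : FreeMonoid (N × α) →* M := annotHom fun a => (s' a).left
  let y : α → N := fun a => (s' a).right
  -- The left components which, together with right component `q`, give an element of `S` lying over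
  -- the class of a word in `L`.
  let P : N → Set M := fun q =>
    {m | ∃ t : S, (t : Semidirect M N) = ⟨m, q⟩ ∧
      ∃ l : List α, l ∈ L ∧ f t = (syntacticCon L).mk' (FreeMonoid.ofList l)}
  have hP : ∀ l : List α,
      l ∈ L ↔ φ (FreeMonoid.ofList (annot y 1 l)) ∈ P (l.map y).prod := by
    intro l
    have hval : ((l.map s).prod : Semidirect M N) =
        ⟨φ (FreeMonoid.ofList (annot y 1 l)), (l.map y).prod⟩ := by
      rw [hcoe]
      ext
      · exact ((annotHom_annot s' 1 l).trans (one_smul _ _)).symm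
      · exact prod_map_right s' l
    constructor
    · exact fun hl => ⟨(l.map s).prod, hval, l, hl, hword l⟩
    · rintro ⟨t, ht, l', hl', h⟩
      rw [← hval] at ht
      rw [Subtype.ext ht, hword] at h
      exact (mem_iff_of_syntacticCon h).2 hl'
  choose F hF hF' using fun q => (hM (N × α) φ (P q)).exists_finite
  refine uDynSigma1_of_annot (y := y) (F := ⋃ q, F q) (fun x => (hinv x).2)
    (Set.finite_iUnion hF)
    -- Any `w` with subword pattern `A` may serve, even one that is not an annotation: the subwords
    -- in `F q` decide whether its image lies in `P q`.
    (fun A q => ∃ w : List (N × α), {u : ⋃ q, F q | u.1 <+ w} = A ∧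
      φ (FreeMonoid.ofList w) ∈ P q) fun l => ?_
  rw [hP]
  constructor
  · exact fun h => ⟨_, rfl, h⟩
  · rintro ⟨w, hw, h⟩
    refine (hF' _ w _ fun u hu => ?_).1 h
    exact Set.ext_iff.1 hw ⟨u, Set.mem_iUnion.2 ⟨_, hu⟩⟩

/-- The language of the empty word is in `UDynΣ₁`. -/
theorem uDynSigma1_one {α : Type} [Finite α] : UDynSigma1 (1 : Language α) := by
  -- With the trivial group, a word is empty exactly when no one-letter word is a subword of its
  -- annotation.
  refine uDynSigma1_of_annot (N := Unit) (y := fun _ => ()) (F := Set.range fun a => [((), a)])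
    (inv := id) (fun _ => rfl) (Set.finite_range _) (fun A _ => A = ∅) fun l => ?_
  rw [Language.mem_one, Set.eq_empty_iff_forall_notMem]
  constructor
  · rintro rfl ⟨_, a, rfl⟩ h
    simp [annot] at h
  · intro h
    cases l with
    | nil => rfl
    | cons a l => exact (h ⟨_, a, rfl⟩ (by simp [annot])).elim

end DynReg

theorem mainTheorem6 :
    (∀ (α : Type) [Finite α] (L : Language α),
      L.IsRegular → DynReg.InJG L → DynReg.UDynSigma1 L) ∧
    (∀ (α : Type) [Finite α] (L : Language α),
      DynReg.UDynSigma1Pos L → DynReg.UDynSigma1 L) ∧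
    (∃ (α : Type) (_ : Finite α) (L : Language α),
      L.IsRegular ∧ DynReg.UDynSigma1 L ∧ ¬ DynReg.UDynSigma1Pos L) :=
  ⟨fun _ _ _ _ h => h.uDynSigma1, fun _ _ _ h => h.uDynSigma1,
    Unit, inferInstance, 1, DynReg.isRegular_one, DynReg.uDynSigma1_one,
    DynReg.not_uDynSigma1Pos_one⟩
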